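/- For a sequence $\pi=(d_1,\dots,d_n)$ of integers let $\Delta(\pi)$ and $\delta(\pi)$ be its largest and smallest entries and $s=\sum_i d_i$ its sum. Call $\pi$ graphic if it is the sequence of vertex degrees of a simple graph on $n$ vertices. For $n\ge 4$ consider all integer sequences $\pi$ of length $n$ with $0\le\delta(\pi)\le\Delta(\pi)\le n-1$, with $s$ even, and with $$\frac{n-2}{4}\le\frac{s}{n}\le\frac{3n-2}{4}.$$ Then there is a largest non-negative integer $m(n)$ such that every such sequence with $\Delta(\pi)-\delta(\pi)\le m(n)$ is graphic, and it satisfies $$\frac{n-2}{4}\le m(n)\le\frac{n-2}{2}.$$ -/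

import Mathlib

/-- The maximum entry `Δ(π)` of a (nonempty, finite) integer sequence. -/
noncomputable def maxEntry {n : ℕ} (π : Fin n → ℤ) : ℤ := ⨆ i, π i

/-- The minimum entry `δ(π)` of a (nonempty, finite) integer sequence. -/
noncomputable def minEntry {n : ℕ} (π : Fin n → ℤ) : ℤ := ⨅ i, π i

/-- An integer sequence of length `n` is graphic if it is the sequence of vertex degrees of a
simple graph on `n` vertices. -/
def IsGraphic {n : ℕ} (π : Fin n → ℤ) : Prop :=
  ∃ (G : SimpleGraph (Fin n)) (_ : DecidableRel G.Adj), ∀ i, (G.degree i : ℤ) = π i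

/-- The integer sequences `π` of length `n` with even sum `s`, with
`0 ≤ δ(π) ≤ Δ(π) ≤ n - 1`, and with `(n - 2) / 4 ≤ s / n ≤ (3 n - 2) / 4`. -/
structure IsCentral {n : ℕ} (π : Fin n → ℤ) : Prop where
  nonneg : 0 ≤ minEntry π
  le_pred : maxEntry π ≤ (n : ℤ) - 1
  even_sum : Even (∑ i, π i)
  le_mean : ((n : ℝ) - 2) / 4 ≤ ((∑ i, π i : ℤ) : ℝ) / n
  mean_le : ((∑ i, π i : ℤ) : ℝ) / n ≤ (3 * (n : ℝ) - 2) / 4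

/-- `Δ(π) - δ(π) ≤ k` forces a sequence of the above class, of length `n`, to be graphic. -/
def ForcesGraphic (n k : ℕ) : Prop :=
  ∀ π : Fin n → ℤ, IsCentral π → maxEntry π - minEntry π ≤ k → IsGraphic π

/-- The threshold `m(n)`: the largest `k` such that `Δ(π) - δ(π) ≤ k` forces graphicness.
(That the maximum exists is asserted separately wherever it matters.) -/
noncomputable def graphicThreshold (n : ℕ) : ℕ := sSup {k : ℕ | ForcesGraphic n k}

/-! Lower bound: let `a`, `b` be the extreme entries, `D = a - b`, and write `s = n * b + p * D + y`
with `p < n` and `0 ≤ y ≤ D`. The sequence with `p` entries `a`, one entry `b + y` and all others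
`b` is the most spread out of sum `s` in `[b, a]`. Only its Erdős–Gallai inequalities at `p` and `p
+ 1` are needed (`criticalInequality` and its complement); they follow from the mean bounds and `4 *
D ≤ n + 1`.

They yield `s / 2` edges with degree sum at least `p * a` on the `p` indices of largest entries and
at most `(n - p - 1) * b` on the `n - p - 1` of smallest (`exists_concentrated`). After balancing
inside these classes (`exists_balanced`), each top degree is at least `a` and each bottom degree at
most `b`. So excess and deficiency are ordered as the entries are, and moving edge ends one at a
time reaches `π` (`exists_edgeDegree_eq`).

Upper bound: with `k = ⌊n / 2⌋`, the sequence `wideSequence n k` has spread at most `k` and is not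
graphic. -/

/-! ### Edge sets, degrees and moves of edge ends -/

section EdgeSets

open Finset

variable {V : Type*} [DecidableEq V]

/-- The number of members of `E` containing `v`. -/
def edgeDegree (E : Finset (Sym2 V)) (v : V) : ℤ := ∑ e ∈ E, if v ∈ e then 1 else 0

/-- The set of all non-diagonal pairs of elements of `S`. -/
def pairs (S : Finset V) : Finset (Sym2 V) := S.offDiag.image (Quot.mk _)

theorem mk_mem_pairs {S : Finset V} {x y : V} :
    s(x, y) ∈ pairs S ↔ x ∈ S ∧ y ∈ S ∧ x ≠ y := by
  unfold pairs
  simp only [mem_image, mem_offDiag, Prod.exists]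
  constructor
  · rintro ⟨u, v, ⟨hu, hv, huv⟩, h⟩
    rcases Sym2.eq_iff.1 h with ⟨rfl, rfl⟩ | ⟨rfl, rfl⟩
    · exact ⟨hu, hv, huv⟩
    · exact ⟨hv, hu, huv.symm⟩
  · rintro ⟨hx, hy, hxy⟩
    exact ⟨x, y, ⟨hx, hy, hxy⟩, rfl⟩

theorem card_pairs (S : Finset V) : #(pairs S) = (#S).choose 2 := Sym2.card_image_offDiag S

theorem two_mul_card_pairs (S : Finset V) : (2 * #(pairs S) : ℤ) = #S * (#S - 1) := by
  rw [card_pairs]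
  have h := Nat.choose_two_right #S
  have h2 := Nat.div_mul_cancel (Nat.even_mul_pred_self #S).two_dvd
  rw [← h] at h2
  rcases Nat.eq_zero_or_pos #S with h0 | h0
  · simp [h0]
  · zify [h0] at h2
    linarith

theorem pairs_mono {S T : Finset V} (h : S ⊆ T) : pairs S ⊆ pairs T :=
  image_subset_image (offDiag_mono h)

variable [Fintype V]

theorem edgeDegree_eq_card (E : Finset (Sym2 V)) (v : V) :
    edgeDegree E v = #{w | s(v, w) ∈ E} := by
  unfold edgeDegree
  rw [sum_boole]
  norm_cast
  symm
  refine card_bij (fun w _ => s(v, w)) ?_ ?_ ?_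
  · intro w hw
    simpa using hw
  · intro w _ w' _ h
    exact Sym2.congr_right.1 h
  · intro e he
    obtain ⟨he, hv⟩ := mem_filter.1 he
    obtain ⟨w, rfl⟩ := Sym2.mem_iff_exists.1 hv
    exact ⟨w, by simpa using he, rfl⟩

/-- If `i` has smaller degree than `j`, one edge end can be moved from `j` to `i`. -/
theorem exists_move {E : Finset (Sym2 V)} (hE : E ⊆ pairs univ) {i j : V}
    (hij : edgeDegree E i < edgeDegree E j) :
    ∃ E' ⊆ pairs univ, ∀ v, edgeDegree E' v =
      edgeDegree E v + (if v = i then 1 else 0) - (if v = j then 1 else 0) := by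
  have hne : i ≠ j := by rintro rfl; exact lt_irrefl _ hij
  obtain ⟨u, hju, hiu, hui⟩ : ∃ u, s(j, u) ∈ E ∧ s(i, u) ∉ E ∧ u ≠ i := by
    rw [edgeDegree_eq_card, edgeDegree_eq_card] at hij
    norm_cast at hij
    by_contra! hcon
    by_cases hadj : s(i, j) ∈ E
    · have h1 : ({w | s(j, w) ∈ E} : Finset V).erase i ⊆ ({w | s(i, w) ∈ E} : Finset V).erase j := by
        intro w hw
        simp only [mem_erase, mem_filter, mem_univ, true_and] at hw ⊢
        refine ⟨?_, ?_⟩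
        · rintro rfl
          exact (mk_mem_pairs.1 (hE hw.2)).2.2 rfl
        · by_contra h
          exact hw.1 (hcon w hw.2 h)
      have h2 := card_le_card h1
      rw [card_erase_of_mem (by simpa [Sym2.eq_swap] using hadj),
        card_erase_of_mem (by simpa using hadj)] at h2
      have h3 : 0 < #({w | s(i, w) ∈ E} : Finset V) := card_pos.2 ⟨j, by simpa using hadj⟩
      omega
    · have h1 : ({w | s(j, w) ∈ E} : Finset V) ⊆ ({w | s(i, w) ∈ E} : Finset V) := by
        intro w hw
        simp only [mem_filter, mem_univ, true_and] at hw ⊢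
        by_contra h
        obtain rfl := hcon w hw h
        exact hadj (by rwa [Sym2.eq_swap])
      exact absurd (card_le_card h1) (by omega)
  have huj : u ≠ j := by
    rintro rfl
    exact (mk_mem_pairs.1 (hE hju)).2.2 rfl
  refine ⟨insert s(i, u) (E.erase s(j, u)), ?_, ?_⟩
  · refine insert_subset (mk_mem_pairs.2 ⟨mem_univ _, mem_univ _, hui.symm⟩) ?_
    exact (erase_subset _ _).trans hE
  · intro v
    unfold edgeDegree
    rw [sum_insert (fun h => hiu (mem_of_mem_erase h)), sum_erase_eq_sub hju]
    simp only [Sym2.mem_iff]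
    by_cases h1 : v = i <;> by_cases h2 : v = j <;> by_cases h3 : v = u <;>
      simp_all <;> ring

/-- An edge set whose degrees sum to the sum of `d` can be turned into one with degree sequence
`d`, if every vertex of excessive degree has a target at least that of every vertex of deficient
degree. -/
theorem exists_edgeDegree_eq (d : V → ℤ) {E : Finset (Sym2 V)} (hE : E ⊆ pairs univ)
    (hsum : ∑ v, edgeDegree E v = ∑ v, d v)
    (hd : ∀ i j, d j < edgeDegree E j → edgeDegree E i < d i → d i ≤ d j) :
    ∃ E' ⊆ pairs univ, ∀ v, edgeDegree E' v = d v := by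
  induction hk : ∑ v, (edgeDegree E v - d v).natAbs using Nat.strong_induction_on generalizing E with
  | _ k ih =>
    by_cases hall : ∀ v, edgeDegree E v = d v
    · exact ⟨E, hE, hall⟩
    have hi : ∃ i, edgeDegree E i < d i := by
      by_contra! h
      exact hall fun v => ((sum_eq_sum_iff_of_le fun v _ => h v).1 hsum.symm v (mem_univ v)).symm
    have hj : ∃ j, d j < edgeDegree E j := by
      by_contra! h
      exact hall fun v => (sum_eq_sum_iff_of_le fun v _ => h v).1 hsum v (mem_univ v)
    obtain ⟨i, hi⟩ := hi
    obtain ⟨j, hj⟩ := hj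
    have hdij := hd i j hj hi
    -- Current degrees satisfy `deg i < d i ≤ d j < deg j`, so the move exists; it brings both
    -- degrees closer to their targets.
    obtain ⟨E', hE', hdeg⟩ := exists_move hE (i := i) (j := j) (by linarith)
    have hne : i ≠ j := by rintro rfl; linarith
    refine ih _ ?_ hE' ?_ ?_ rfl
    · rw [← hk]
      refine sum_lt_sum (fun v _ => ?_) ⟨i, mem_univ i, ?_⟩
      · rw [hdeg]
        by_cases h1 : v = i
        · subst h1
          simp only [if_true, if_neg hne]
          omega
        · by_cases h2 : v = j
          · subst h2
            simp only [if_true, if_neg h1]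
            omega
          · simp [h1, h2]
      · rw [hdeg]
        simp only [if_true, if_neg hne]
        omega
    · simp [hdeg, sum_add_distrib, hsum]
    · intro v w hw hv
      rw [hdeg] at hw hv
      refine hd v w ?_ ?_
      · by_cases h1 : w = i
        · subst h1
          simp only [if_true, if_neg hne] at hw
          omega
        · simp only [if_neg h1] at hw
          split_ifs at hw <;> omega
      · by_cases h2 : v = j
        · subst h2
          simp only [if_true, if_neg hne.symm] at hv
          omega
        · simp only [if_neg h2] at hv
          split_ifs at hv <;> omega

/-- Degrees can be balanced inside the classes of a colouring, keeping the degree sums of the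
classes. -/
theorem exists_balanced {ι : Type*} [DecidableEq ι] (c : V → ι) {E : Finset (Sym2 V)}
    (hE : E ⊆ pairs univ) :
    ∃ E' ⊆ pairs univ,
      (∀ k, ∑ v with c v = k, edgeDegree E' v = ∑ v with c v = k, edgeDegree E v) ∧
      ∀ i j, c i = c j → edgeDegree E' j ≤ edgeDegree E' i + 1 := by
  induction hk : (∑ v, edgeDegree E v ^ 2).toNat using Nat.strong_induction_on
    generalizing E with
  | _ k ih =>
    by_cases hall : ∀ i j, c i = c j → edgeDegree E j ≤ edgeDegree E i + 1
    · exact ⟨E, hE, fun _ => rfl, hall⟩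
    push Not at hall
    obtain ⟨i, j, hc, hij⟩ := hall
    obtain ⟨E', hE', hdeg⟩ := exists_move hE (i := i) (j := j) (by linarith)
    have hne : i ≠ j := by rintro rfl; linarith
    -- The sum of squared degrees drops because the two degrees differ by at least 2.
    have hlt : ∑ v, edgeDegree E' v ^ 2 < ∑ v, edgeDegree E v ^ 2 := by
      have key : ∀ v, edgeDegree E' v ^ 2 = edgeDegree E v ^ 2
          + (if v = i then 2 * edgeDegree E i + 1 else 0)
          - (if v = j then 2 * edgeDegree E j - 1 else 0) := by
        intro v
        rw [hdeg]
        by_cases h1 : v = i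
        · subst h1
          simp only [if_true, if_neg hne]
          ring
        · by_cases h2 : v = j
          · subst h2
            simp only [if_true, if_neg h1]
            ring
          · simp [h1, h2]
      simp only [key, sum_add_distrib, sum_sub_distrib, sum_ite_eq', mem_univ, if_true]
      linarith
    have hnn : 0 ≤ ∑ v, edgeDegree E' v ^ 2 := sum_nonneg fun v _ => sq_nonneg _
    obtain ⟨E'', h1, h2, h3⟩ := ih _ (by omega) hE' rfl
    refine ⟨E'', h1, fun k => (h2 k).trans ?_, h3⟩
    simp [hdeg, sum_add_distrib, sum_ite_eq', hc]

/-- An edge inside `S` counts twice and an edge with one end in `S` once; the second term counts all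
edges meeting `S`. -/
theorem sum_edgeDegree {E : Finset (Sym2 V)} (hE : E ⊆ pairs univ) (S : Finset V) :
    ∑ v ∈ S, edgeDegree E v = (#(E ∩ pairs S) + #(E \ pairs Sᶜ) : ℤ) := by
  unfold edgeDegree
  rw [sum_comm]
  have key : ∀ e ∈ E, (∑ v ∈ S, if v ∈ e then (1 : ℤ) else 0) =
      (if e ∈ pairs S then 1 else 0) + (if e ∉ pairs Sᶜ then 1 else 0) := by
    intro e he
    have hp := hE he
    induction e with
    | h x y =>
      have hxy := (mk_mem_pairs.1 hp).2.2
      have : ∀ v, (if v ∈ s(x, y) then (1 : ℤ) else 0)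
          = (if v = x then 1 else 0) + (if v = y then 1 else 0) := by
        intro v
        by_cases h1 : v = x
        · subst h1; simp [hxy]
        · simp [h1]
      simp only [this, sum_add_distrib, sum_ite_eq', mk_mem_pairs, mem_compl]
      by_cases h1 : x ∈ S <;> by_cases h2 : y ∈ S <;> simp [h1, h2, hxy]
  rw [sum_congr rfl key, sum_add_distrib, sum_boole, sum_boole, filter_mem_eq_inter,
    filter_notMem_eq_sdiff]

/-- In a chain of four subsets of a finite set there is room for a set of any size that is
comparable with all of them. -/
theorem exists_card_eq_comparable {α : Type*} [DecidableEq α] {A B C D T : Finset α} {m : ℕ}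
    (hAB : A ⊆ B) (hBC : B ⊆ C) (hCD : C ⊆ D) (hDT : D ⊆ T) (hm : m ≤ #T) :
    ∃ E ⊆ T, #E = m ∧ (E ⊆ A ∨ A ⊆ E) ∧ (E ⊆ B ∨ B ⊆ E) ∧ (E ⊆ C ∨ C ⊆ E) ∧ (E ⊆ D ∨ D ⊆ E) := by
  have main : ∀ X Y : Finset α, X ⊆ Y → #X ≤ m → m ≤ #Y → ∃ E, X ⊆ E ∧ E ⊆ Y ∧ #E = m :=
    fun X Y h h1 h2 => exists_subsuperset_card_eq h h1 h2
  rcases le_total m #A with hA | hA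
  · obtain ⟨E, -, h, hc⟩ := main ∅ A (empty_subset _) (by simp) hA
    have hB := h.trans hAB
    have hC := hB.trans hBC
    have hD := hC.trans hCD
    exact ⟨E, hD.trans hDT, hc, .inl h, .inl hB, .inl hC, .inl hD⟩
  rcases le_total m #B with hB | hB
  · obtain ⟨E, h, hB, hc⟩ := main A B hAB hA hB
    have hC := hB.trans hBC
    have hD := hC.trans hCD
    exact ⟨E, hD.trans hDT, hc, .inr h, .inl hB, .inl hC, .inl hD⟩
  rcases le_total m #C with hC | hC
  · obtain ⟨E, h, hC, hc⟩ := main B C hBC hB hC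
    have hD := hC.trans hCD
    exact ⟨E, hD.trans hDT, hc, .inr (hAB.trans h), .inr h, .inl hC, .inl hD⟩
  rcases le_total m #D with hD | hD
  · obtain ⟨E, h, hD, hc⟩ := main C D hCD hC hD
    have hB := hBC.trans h
    exact ⟨E, hD.trans hDT, hc, .inr (hAB.trans hB), .inr hB, .inr h, .inl hD⟩
  · obtain ⟨E, h, hT, hc⟩ := main D T hDT hD hm
    have hC := hCD.trans h
    have hB := hBC.trans hC
    exact ⟨E, hT, hc, .inr (hAB.trans hB), .inr hB, .inr hC, .inr h⟩

theorem card_inter_of_comparable {α : Type*} [DecidableEq α] {E A : Finset α}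
    (h : E ⊆ A ∨ A ⊆ E) : #(E ∩ A) = min #E #A := by
  rcases h with h | h
  · rw [inter_eq_left.2 h, min_eq_left (card_le_card h)]
  · rw [inter_eq_right.2 h, min_eq_right (card_le_card h)]

end EdgeSets

/-! ### The two critical Erdős–Gallai inequalities -/

/-- The sign of `n - 2 * p` decides which mean bound eliminates `b`. Replacing `D` by `(n + 1) / 4`
and dropping `y` then leaves a quadratic in `p`, handled by completing the square. -/
theorem criticalInequality {n p D b y : ℤ} (hn : 4 ≤ n) (hp0 : 0 ≤ p) (hpn : p ≤ n - 1)
    (hD0 : 0 ≤ D) (hD : 4 * D ≤ n + 1) (hy0 : 0 ≤ y) (hyD : y ≤ D)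
    (hlo : n * (n - 2) ≤ 4 * (p * D + y + n * b)) (hhi : 4 * (p * D + y + n * b) ≤ n * (3 * n - 2)) :
    p * (D + 1 - p) ≤ y + (n - 2 * p) * b := by
  -- The quadratic argument needs `2 * n ^ 2 - 14 * n - 5 ≥ 0`, which fails at `n = 7`.
  rcases lt_or_ge n 8 with h8 | h8
  · have hD2 : D ≤ 2 := by omega
    have hp6 : p ≤ 6 := by omega
    interval_cases n <;> interval_cases D <;> (try omega) <;> interval_cases p <;> omega
  have hpos : 0 < n := by linarith
  rcases le_total (2 * p) n with h | h
  · have key : 0 ≤ n ^ 3 - 2 * n ^ 2 - p * (4 * n ^ 2 + 2 * n) + (6 * n + 2) * p ^ 2 := by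
      have : 0 ≤ 4 * (6 * n + 2) *
          (n ^ 3 - 2 * n ^ 2 - p * (4 * n ^ 2 + 2 * n) + (6 * n + 2) * p ^ 2) := by
        have h1 : 0 ≤ 4 * n ^ 2 * (2 * n ^ 2 - 14 * n - 5) :=
          mul_nonneg (by positivity) (by nlinarith)
        have h2 := sq_nonneg (2 * (6 * n + 2) * p - (4 * n ^ 2 + 2 * n))
        linarith
      exact nonneg_of_mul_nonneg_right this (by linarith)
    have h1 := mul_le_mul_of_nonneg_left hlo (sub_nonneg.2 h)
    have h2 : 0 ≤ (n - p) * p * (n + 1 - 4 * D) :=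
      mul_nonneg (mul_nonneg (by linarith) hp0) (by linarith)
    have h3 : 0 ≤ p * y := mul_nonneg hp0 hy0
    refine le_of_mul_le_mul_left ?_ (show 0 < 4 * n by linarith)
    linarith
  · have key : 0 ≤ (6 * n + 2) * p ^ 2 - p * (8 * n ^ 2 + 2 * n) + 3 * n ^ 3 - 2 * n ^ 2 := by
      have : 0 ≤ 4 * (6 * n + 2) *
          ((6 * n + 2) * p ^ 2 - p * (8 * n ^ 2 + 2 * n) + 3 * n ^ 3 - 2 * n ^ 2) := by
        have h1 : 0 ≤ 4 * n ^ 2 * (2 * n ^ 2 - 14 * n - 5) :=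
          mul_nonneg (by positivity) (by nlinarith)
        have h2 := sq_nonneg (2 * (6 * n + 2) * p - (8 * n ^ 2 + 2 * n))
        linarith
      exact nonneg_of_mul_nonneg_right this (by linarith)
    have h1 := mul_le_mul_of_nonneg_left hhi (sub_nonneg.2 h)
    have h2 : 0 ≤ (n - p) * p * (n + 1 - 4 * D) :=
      mul_nonneg (mul_nonneg (by linarith) hp0) (by linarith)
    have h3 : 0 ≤ p * y := mul_nonneg hp0 hy0
    refine le_of_mul_le_mul_left ?_ (show 0 < 4 * n by linarith)
    linarith

/-- Passing to the complementary graph replaces each entry `d` by `n - 1 - d` and exchanges the two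
mean bounds. -/
theorem criticalInequality_compl {n p D b y : ℤ} (hn : 4 ≤ n) (hp0 : 0 ≤ p) (hpn : p ≤ n - 1)
    (hD0 : 0 ≤ D) (hD : 4 * D ≤ n + 1) (hy0 : 0 ≤ y) (hyD : y ≤ D)
    (hlo : n * (n - 2) ≤ 4 * (p * D + y + n * b)) (hhi : 4 * (p * D + y + n * b) ≤ n * (3 * n - 2)) :
    p * (D - 1 - p) + y ≤ (n - 2 * p - 2) * b := by
  have h := criticalInequality (n := n) (p := n - 1 - p) (D := D) (b := n - 1 - b - D)
    (y := D - y) hn (by linarith) (by linarith) hD0 hD (by linarith) (by linarith)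
    (by linarith) (by linarith)
  linarith

/-! ### Realizing sequences of small spread -/

open Finset in
/-- An edge set of prescribed size which is concentrated on `P` and thin on `Q`, where `P` and `Q`
together miss exactly one vertex `v`. -/
theorem exists_concentrated {V : Type*} [Fintype V] [DecidableEq V] {P Q : Finset V} {v : V}
    (hvP : v ∉ P) (hQ : Q = (insert v P)ᶜ) {a b x n p s : ℤ} (hn : n = Fintype.card V)
    (hp : p = #P) (hb : 0 ≤ b) (hbx : b ≤ x) (hxa : x ≤ a) (han : a ≤ n - 1)
    (hs : s = p * a + x + (n - p - 1) * b) (hev : Even s)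
    (h1 : p * (a + 1 - p) ≤ x + (n - p - 1) * b)
    (h2 : p * (a - 1 - p) + x ≤ (n - p - 1) * b) :
    ∃ E ⊆ pairs (univ : Finset V), ∑ u, edgeDegree E u = s ∧
      p * a ≤ ∑ u ∈ P, edgeDegree E u ∧ ∑ u ∈ Q, edgeDegree E u ≤ (n - p - 1) * b := by
  have hp0 : 0 ≤ p := by omega
  have hins : #(insert v P) = #P + 1 := card_insert_of_notMem hvP
  have hpn : p + 1 ≤ n := by
    have := card_le_univ (insert v P)
    omega
  have hQc : Qᶜ = insert v P := by rw [hQ, compl_compl]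
  have hcQ : (#Q : ℤ) = n - p - 1 := by
    have := card_add_card_compl (insert v P)
    rw [← hQ] at this
    omega
  have hcP : (#Pᶜ : ℤ) = n - p := by
    have := card_add_card_compl P
    omega
  have hQP : Q ⊆ Pᶜ := by
    rw [hQ]
    exact compl_subset_compl.2 (subset_insert _ _)
  have hq0 : 0 ≤ (n - p - 1) * b := mul_nonneg (by linarith) hb
  have hs0 : 0 ≤ s := by
    have : 0 ≤ p * a := mul_nonneg hp0 (by linarith)
    linarith
  obtain ⟨m', hm'⟩ := hev
  obtain ⟨m, rfl⟩ : ∃ m : ℕ, m' = m := ⟨m'.toNat, by omega⟩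
  have cT := two_mul_card_pairs (univ : Finset V)
  rw [card_univ, ← hn] at cT
  have cA := two_mul_card_pairs P
  have cB := two_mul_card_pairs (insert v P)
  have cPc := two_mul_card_pairs Pᶜ
  have cQ := two_mul_card_pairs Q
  rw [hins] at cB
  rw [hcP] at cPc
  rw [hcQ] at cQ
  push_cast at cB
  rw [← hp] at cA cB
  have cC : (#(pairs univ \ pairs Pᶜ) : ℤ) = #(pairs (univ : Finset V)) - #(pairs Pᶜ) :=
    cast_card_sdiff (pairs_mono (subset_univ _))
  have cD : (#(pairs univ \ pairs Q) : ℤ) = #(pairs (univ : Finset V)) - #(pairs Q) :=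
    cast_card_sdiff (pairs_mono (subset_univ _))
  have hmT : m ≤ #(pairs (univ : Finset V)) := by
    have e1 : p * a ≤ p * (n - 1) := mul_le_mul_of_nonneg_left han hp0
    have e2 : (n - p - 1) * b ≤ (n - p - 1) * (n - 1) :=
      mul_le_mul_of_nonneg_left (by linarith) (by linarith)
    zify
    linarith
  have hBC : pairs (insert v P) ⊆ pairs univ \ pairs Pᶜ := by
    intro e he
    induction e with
    | h x y =>
      simp only [mk_mem_pairs, mem_insert, mem_sdiff, mem_univ, true_and, mem_compl] at he ⊢
      grind
  -- The chain: pairs inside `P`, pairs inside `P ∪ {v}`, pairs meeting `P`, pairs meeting `P ∪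
  -- {v}`. Comparability makes every intersection size a minimum.
  obtain ⟨E, hE, hcard, hA, hB, hC, hD⟩ := exists_card_eq_comparable
    (pairs_mono (subset_insert v P)) hBC
    (sdiff_subset_sdiff subset_rfl (pairs_mono hQP)) sdiff_subset hmT
  have hAC : (#(pairs P) : ℤ) ≤ #(pairs univ \ pairs Pᶜ) := by
    exact_mod_cast card_le_card ((pairs_mono (subset_insert v P)).trans hBC)
  have hBD : (#(pairs (insert v P)) : ℤ) ≤ #(pairs univ \ pairs Q) := by
    exact_mod_cast card_le_card (hBC.trans (sdiff_subset_sdiff subset_rfl (pairs_mono hQP)))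
  have sdiff_eq : ∀ X : Finset V, E \ pairs X = E ∩ (pairs univ \ pairs X) := by
    intro X
    rw [← inter_sdiff_assoc, inter_eq_left.2 hE]
  have inter_Q : (#(E ∩ pairs Q) : ℤ) = #E - #(E ∩ (pairs univ \ pairs Q)) := by
    have := card_sdiff_add_card_inter E (pairs Q)
    rw [sdiff_eq] at this
    omega
  have sdiff_B : (#(E \ pairs (insert v P)) : ℤ) = #E - #(E ∩ pairs (insert v P)) := by
    have := card_sdiff_add_card_inter E (pairs (insert v P))
    omega
  refine ⟨E, hE, ?_, ?_, ?_⟩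
  · rw [sum_edgeDegree hE, inter_eq_left.2 hE, compl_univ]
    simp [pairs, hcard, hm']
  · rw [sum_edgeDegree hE, sdiff_eq, card_inter_of_comparable hA, card_inter_of_comparable hC,
      hcard]
    have e1 : p * a ≤ p * (n - 1) := mul_le_mul_of_nonneg_left han hp0
    push_cast
    -- Only the case `#(pairs P) ≤ m ≤ #(pairs univ \ pairs Pᶜ)` uses `h1`; the middle case for `Q`
    -- likewise uses `h2`.
    rcases le_total (m : ℤ) #(pairs P) with h | h <;>
    rcases le_total (m : ℤ) #(pairs univ \ pairs Pᶜ) with h' | h' <;>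
    simp only [h, h', min_eq_left, min_eq_right] <;> linarith
  · rw [sum_edgeDegree hE, hQc, inter_Q, sdiff_B, card_inter_of_comparable hB,
      card_inter_of_comparable hD, hcard]
    have e1 : p * a ≤ p * (n - 1) := mul_le_mul_of_nonneg_left han hp0
    push_cast
    rcases le_total (m : ℤ) #(pairs (insert v P)) with h | h <;>
    rcases le_total (m : ℤ) #(pairs univ \ pairs Q) with h' | h' <;>
    simp only [h, h', min_eq_left, min_eq_right] <;> linarith

open Finset in
theorem isGraphic_of_edgeDegree {n : ℕ} {π : Fin n → ℤ} {E : Finset (Sym2 (Fin n))}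
    (hE : E ⊆ pairs univ) (h : ∀ v, edgeDegree E v = π v) : IsGraphic π := by
  classical
  refine ⟨SimpleGraph.fromEdgeSet (E : Set (Sym2 (Fin n))), inferInstance, fun v => ?_⟩
  rw [← h, edgeDegree_eq_card, ← SimpleGraph.card_neighborFinset_eq_degree]
  congr 2
  ext w
  simp only [SimpleGraph.mem_neighborFinset, SimpleGraph.fromEdgeSet_adj, mem_coe, mem_filter,
    mem_univ, true_and, and_iff_left_iff_imp]
  exact fun hw => (mk_mem_pairs.1 (hE hw)).2.2

/-- An integer from `[0, n * D]` is `p * D + y` with `p < n` and `0 ≤ y ≤ D`. -/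
theorem exists_quotient {n : ℕ} (hn : 0 < n) {t D : ℤ} (ht0 : 0 ≤ t) (ht : t ≤ n * D) :
    ∃ (p : ℕ) (y : ℤ), p < n ∧ 0 ≤ y ∧ y ≤ D ∧ t = p * D + y := by
  induction n, hn using Nat.le_induction with
  | base => exact ⟨0, t, by simp, ht0, by simpa using ht, by simp⟩
  | succ n hn ih =>
    rcases le_total t (n * D) with h | h
    · obtain ⟨p, y, h1, h2⟩ := ih h
      exact ⟨p, y, by omega, h2⟩
    · exact ⟨n, t - n * D, by omega, by linarith, by push_cast at ht; linarith, by ring⟩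

open Finset in
theorem isGraphic_of_spread_le {n : ℕ} (hn : 4 ≤ n) {π : Fin n → ℤ} {a b : ℤ} (hb : 0 ≤ b)
    (hbπ : ∀ i, b ≤ π i) (hπa : ∀ i, π i ≤ a) (ha : a ≤ n - 1) (hab : 4 * (a - b) ≤ n + 1)
    (hev : Even (∑ i, π i)) (hlo : (n : ℤ) * (n - 2) ≤ 4 * ∑ i, π i)
    (hhi : 4 * ∑ i, π i ≤ (n : ℤ) * (3 * n - 2)) : IsGraphic π := by
  have hba : b ≤ a := (hbπ ⟨0, by omega⟩).trans (hπa _)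
  have hsb : (n : ℤ) * b ≤ ∑ i, π i := by
    simpa using card_nsmul_le_sum univ π b fun i _ => hbπ i
  have hsa : ∑ i, π i ≤ (n : ℤ) * a := by
    simpa using sum_le_card_nsmul univ π a fun i _ => hπa i
  -- Allowing `y = D` keeps `p < n` even when all entries equal `a`, so the middle vertex always
  -- exists.
  obtain ⟨p, y, hpn, hy0, hyD, hs⟩ := exists_quotient (n := n) (by omega)
    (t := ∑ i, π i - n * b) (D := a - b) (by linarith) (by linarith)
  have hn' : (4 : ℤ) ≤ n := by exact_mod_cast hn
  have hpn' : (p : ℤ) ≤ n - 1 := by omega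
  have hsum : ∑ i, π i = p * (a - b) + y + n * b := by linarith
  rw [hsum] at hlo hhi
  have k1 := criticalInequality hn' (Int.natCast_nonneg p) hpn' (by linarith) hab hy0 hyD hlo hhi
  have k2 := criticalInequality_compl hn' (Int.natCast_nonneg p) hpn' (by linarith) hab hy0 hyD
    hlo hhi
  -- the rank of an index, in decreasing order of the entries
  let σ := Tuple.sort fun i => -π i
  let r : Fin n → ℕ := fun i => σ.symm i
  have hr : ∀ i j, r i ≤ r j → π j ≤ π i := by
    intro i j hij
    have := Tuple.monotone_sort (fun i => -π i) (show σ.symm i ≤ σ.symm j from hij)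
    simpa [σ] using this
  let v : Fin n := σ ⟨p, hpn⟩
  have hrv : ∀ i, r i = p ↔ i = v := by
    intro i
    simp only [r, v]
    rw [← Equiv.symm_apply_eq, Fin.ext_iff]
  let c : Fin n → Ordering := fun i => cmp (r i) p
  let P : Finset (Fin n) := {i | c i = .lt}
  let Q : Finset (Fin n) := {i | c i = .gt}
  have memP : ∀ i, i ∈ P ↔ r i < p := by simp [P, c]
  have memQ : ∀ i, i ∈ Q ↔ p < r i := by simp [Q, c]
  have hcardP : #P = p := by
    have : #P = #(Iio (⟨p, hpn⟩ : Fin n)) := by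
      refine card_bij (fun i _ => σ.symm i) ?_ (fun _ _ _ _ h => σ.symm.injective h) ?_
      · intro i hi
        simpa [Fin.lt_def] using (memP i).1 hi
      · intro i hi
        refine ⟨σ i, (memP _).2 ?_, by simp⟩
        simpa [r, Fin.lt_def] using hi
    simpa using this
  have hvP : v ∉ P := by
    rw [memP, (hrv v).2 rfl]
    exact lt_irrefl _
  have hQ : Q = (insert v P)ᶜ := by
    ext i
    rw [mem_compl, mem_insert, memQ, memP, ← hrv]
    omega
  have hcardQ : (#Q : ℤ) = n - p - 1 := by
    rw [hQ, card_compl, card_insert_of_notMem hvP, hcardP, Fintype.card_fin]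
    omega
  obtain ⟨E₀, hE₀, hE₀s, hE₀P, hE₀Q⟩ := exists_concentrated (P := P) (Q := Q) (v := v) hvP hQ
    (a := a) (b := b) (x := b + y) (n := n) (p := p) (s := ∑ i, π i) (by simp) (by simp [hcardP]) hb
    (by linarith) (by linarith) ha (by rw [hsum]; ring) hev (by linarith) (by linarith)
  obtain ⟨E, hE, hEs, hEb⟩ := exists_balanced c hE₀
  have hsumE : ∑ i, edgeDegree E i = ∑ i, π i := by
    rw [← hE₀s, ← sum_fiberwise univ c (edgeDegree E), ← sum_fiberwise univ c (edgeDegree E₀)]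
    exact sum_congr rfl fun k _ => hEs k
  -- One degree below `a` would, by balance, force all degrees on `P` to be at most `a`, making
  -- their sum less than `p * a`.
  have hP : ∀ i ∈ P, a ≤ edgeDegree E i := by
    intro i hi
    by_contra! hlt
    have h1 : ∑ j ∈ P, edgeDegree E j < ∑ j ∈ P, a := by
      refine sum_lt_sum (fun j hj => ?_) ⟨i, hi, hlt⟩
      have := hEb i j (((mem_filter.1 hi).2).trans ((mem_filter.1 hj).2).symm)
      linarith
    rw [sum_const, hcardP, nsmul_eq_mul] at h1
    have := hEs .lt
    linarith
  have hQ' : ∀ i ∈ Q, edgeDegree E i ≤ b := by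
    intro i hi
    by_contra! hlt
    have h1 : ∑ j ∈ Q, b < ∑ j ∈ Q, edgeDegree E j := by
      refine sum_lt_sum (fun j hj => ?_) ⟨i, hi, hlt⟩
      have := hEb j i (((mem_filter.1 hj).2).trans ((mem_filter.1 hi).2).symm)
      linarith
    rw [sum_const, nsmul_eq_mul, hcardQ] at h1
    have := hEs .gt
    linarith
  obtain ⟨E', hE', hdeg⟩ := exists_edgeDegree_eq π hE hsumE (by
    intro i j hj hi
    apply hr
    have h1 : j ∉ Q := fun h => by linarith [hQ' j h, hbπ j]
    have h2 : i ∉ P := fun h => by linarith [hP i h, hπa i]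
    rw [memQ] at h1
    rw [memP] at h2
    omega)
  exact isGraphic_of_edgeDegree hE' hdeg

/-! ### Bounds on the threshold -/

theorem le_maxEntry {n : ℕ} (π : Fin n → ℤ) (i : Fin n) : π i ≤ maxEntry π :=
  le_ciSup (Set.finite_range π).bddAbove i

theorem minEntry_le {n : ℕ} (π : Fin n → ℤ) (i : Fin n) : minEntry π ≤ π i :=
  ciInf_le (Set.finite_range π).bddBelow i

theorem forcesGraphic_quarter {n : ℕ} (hn : 4 ≤ n) : ForcesGraphic n ((n + 1) / 4) := by
  intro π hπ hspread
  have hpos : (0 : ℝ) < n := by positivity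
  have hlo := hπ.le_mean
  have hhi := hπ.mean_le
  rw [le_div_iff₀ hpos] at hlo
  rw [div_le_iff₀ hpos] at hhi
  refine isGraphic_of_spread_le hn hπ.nonneg (minEntry_le π) (le_maxEntry π) hπ.le_pred ?_
    hπ.even_sum ?_ ?_
  · push_cast at hspread
    omega
  · have : ((n : ℝ) * (n - 2)) ≤ 4 * ((∑ i, π i : ℤ) : ℝ) := by linarith
    exact_mod_cast this
  · have : 4 * ((∑ i, π i : ℤ) : ℝ) ≤ (n : ℝ) * (3 * n - 2) := by linarith
    exact_mod_cast this

theorem ForcesGraphic.mono {n k l : ℕ} (h : ForcesGraphic n l) (hkl : k ≤ l) :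
    ForcesGraphic n k := fun π hπ hs => h π hπ (hs.trans (by exact_mod_cast hkl))

/-- `k` entries `k`, followed by the parity of `k` and zeros. -/
def wideSequence (n k : ℕ) (i : Fin n) : ℤ :=
  if (i : ℕ) < k then k else if (i : ℕ) = k then (k % 2 : ℕ) else 0

theorem sum_wideSequence {n k : ℕ} (hk : k < n) :
    ∑ i, wideSequence n k i = k * k + (k % 2 : ℕ) := by
  unfold wideSequence
  rw [Fin.sum_univ_eq_sum_range
    (fun i => if i < k then (k : ℤ) else if i = k then ((k % 2 : ℕ) : ℤ) else 0) n,
    ← Finset.sum_subset (Finset.range_subset_range.2 hk)]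
  · rw [Finset.sum_range_succ, Finset.sum_congr rfl (g := fun _ => (k : ℤ))]
    · simp
    · intro i hi
      simp [Finset.mem_range.1 hi]
  · intro i _ hi
    rw [Finset.mem_range] at hi
    rw [if_neg (by omega), if_neg (by omega)]

/-- Each of the first `k` vertices needs `k` neighbours among the other vertices of index at most
`k`, hence is adjacent to vertex `k`. That vertex would have degree at least `k ≥ 2`, but its entry
is at most 1. -/
theorem not_isGraphic_wideSequence {n k : ℕ} (hk2 : 2 ≤ k) (hk : k < n) :
    ¬ IsGraphic (wideSequence n k) := by
  rintro ⟨G, _, hG⟩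
  let v : Fin n := ⟨k, hk⟩
  have hadj : ∀ i : Fin n, (i : ℕ) < k → G.Adj i v := by
    intro i hi
    by_contra hcon
    have hsub : G.neighborFinset i ⊆ (Finset.Iio v).erase i := by
      intro j hj
      rw [SimpleGraph.mem_neighborFinset] at hj
      rw [Finset.mem_erase, Finset.mem_Iio, Fin.lt_def]
      refine ⟨hj.ne', ?_⟩
      by_contra hjk
      rcases (not_lt.1 hjk).eq_or_lt with h | h
      · exact hcon (by rwa [show v = j from Fin.ext h])
      · have h0 := hG j
        simp only [v] at h
        rw [wideSequence, if_neg (by omega), if_neg (by omega)] at h0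
        have hpos := (G.degree_pos_iff_exists_adj j).2 ⟨i, hj.symm⟩
        omega
    have hcard := Finset.card_le_card hsub
    have hiv : i ∈ Finset.Iio v := Finset.mem_Iio.2 hi
    rw [Finset.card_erase_of_mem hiv, Fin.card_Iio, SimpleGraph.card_neighborFinset_eq_degree]
      at hcard
    have h0 := hG i
    rw [wideSequence, if_pos hi] at h0
    simp only [v] at hcard
    omega
  have hsub : Finset.Iio v ⊆ G.neighborFinset v := by
    intro i hi
    rw [SimpleGraph.mem_neighborFinset]
    exact (hadj i (Fin.lt_def.1 (Finset.mem_Iio.1 hi))).symm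
  have hcard := Finset.card_le_card hsub
  rw [Fin.card_Iio, SimpleGraph.card_neighborFinset_eq_degree] at hcard
  have h0 := hG v
  simp only [wideSequence, v, lt_irrefl, if_false, if_true] at h0
  simp only [v] at hcard
  omega

theorem wideSequence_bounds {n k : ℕ} (hk2 : 2 ≤ k) (i : Fin n) :
    0 ≤ wideSequence n k i ∧ wideSequence n k i ≤ k := by
  unfold wideSequence
  split_ifs <;> omega

theorem not_forcesGraphic_half {n : ℕ} (hn : 4 ≤ n) : ¬ ForcesGraphic n (n / 2) := by
  intro h
  have hk2 : 2 ≤ n / 2 := by omega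
  have hkn : n / 2 < n := by omega
  obtain ⟨k, hk⟩ : ∃ k, k = n / 2 := ⟨_, rfl⟩
  rw [← hk] at h hk2 hkn
  have : Nonempty (Fin n) := ⟨⟨0, by omega⟩⟩
  have hmax : maxEntry (wideSequence n k) ≤ k := ciSup_le fun i => (wideSequence_bounds hk2 i).2
  have hmin : 0 ≤ minEntry (wideSequence n k) := le_ciInf fun i => (wideSequence_bounds hk2 i).1
  have hsum := sum_wideSequence hkn
  have hpos : (0 : ℝ) < n := by positivity
  have hlo : (n : ℤ) * (n - 2) ≤ 4 * (k * k + (k % 2 : ℕ)) := by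
    rcases Nat.even_or_odd' n with ⟨m, rfl | rfl⟩
    · obtain rfl : k = m := by omega
      push_cast
      nlinarith [Int.emod_nonneg (k : ℤ) two_ne_zero]
    · obtain rfl : k = m := by omega
      push_cast
      nlinarith [Int.emod_nonneg (k : ℤ) two_ne_zero]
  have hhi : 4 * ((k : ℤ) * k + (k % 2 : ℕ)) ≤ (n : ℤ) * (3 * n - 2) := by
    have h1 : ((k % 2 : ℕ) : ℤ) ≤ 1 := by omega
    have h2 : 2 * (k : ℤ) ≤ n := by omega
    have h3 : (2 : ℤ) ≤ k := by omega
    nlinarith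
  refine not_isGraphic_wideSequence hk2 hkn (h _ ⟨hmin, hmax.trans (by omega), ?_, ?_, ?_⟩
    (by linarith))
  · rw [hsum]
    norm_cast
    rcases Nat.even_or_odd k with he | ho
    · simp [Nat.even_iff.1 he, he]
    · rw [Nat.odd_iff.1 ho]
      exact (ho.mul ho).add_one
  · rw [le_div_iff₀ hpos, hsum]
    have : ((n : ℝ) * (n - 2)) ≤ 4 * (((k : ℤ) * k + (k % 2 : ℕ) : ℤ) : ℝ) := by exact_mod_cast hlo
    linarith
  · rw [div_le_iff₀ hpos, hsum]
    have : 4 * (((k : ℤ) * k + (k % 2 : ℕ) : ℤ) : ℝ) ≤ (n : ℝ) * (3 * n - 2) := by exact_mod_cast hhi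
    linarith

theorem mainTheorem2 (n : ℕ) (hn : 4 ≤ n) :
    IsGreatest {k : ℕ | ForcesGraphic n k} (graphicThreshold n) ∧
      ((n : ℝ) - 2) / 4 ≤ (graphicThreshold n : ℝ) ∧
      (graphicThreshold n : ℝ) ≤ ((n : ℝ) - 2) / 2 := by
  have hne : (n + 1) / 4 ∈ {k : ℕ | ForcesGraphic n k} := forcesGraphic_quarter hn
  have hlt : ∀ k ∈ {k : ℕ | ForcesGraphic n k}, k < n / 2 := by
    intro k hk
    by_contra! h
    exact not_forcesGraphic_half hn (ForcesGraphic.mono hk h)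
  have hbdd : BddAbove {k : ℕ | ForcesGraphic n k} := ⟨n / 2, fun k hk => (hlt k hk).le⟩
  have hmem : graphicThreshold n ∈ {k : ℕ | ForcesGraphic n k} := Nat.sSup_mem ⟨_, hne⟩ hbdd
  -- The floor of `(n + 1) / 4` is the ceiling of `(n - 2) / 4`.
  have hge : (n + 1) / 4 ≤ graphicThreshold n := le_csSup hbdd hne
  refine ⟨⟨hmem, fun k hk => le_csSup hbdd hk⟩, ?_, ?_⟩
  · have h : n ≤ 4 * graphicThreshold n + 2 := by omega
    have : (n : ℝ) ≤ 4 * graphicThreshold n + 2 := by exact_mod_cast h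
    linarith
  · have h : 2 * graphicThreshold n + 2 ≤ n := by
      have := hlt _ hmem
      omega
    have : 2 * (graphicThreshold n : ℝ) + 2 ≤ n := by exact_mod_cast h
    linarith
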